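/- Let $A$ be a finite-dimensional algebra over a field, and let $\mathscr{A}=A\text{-}\mathrm{mod}$ be the category of finitely generated left $A$-modules. Let $\mathcal{G}(A)\subseteq\mathscr{A}$ be the full subcategory of Gorenstein projective modules, that is, of modules isomorphic to $\operatorname{Im}(T^{-1}\to T^{0})$ for some exact complex $T^\bullet$ of finitely generated projective $A$-modules such that $\operatorname{Hom}_A(T^\bullet,Q)$ is exact for every finitely generated projective $A$-module $Q$. Let $K^b(\mathscr{A})$ be the bounded homotopy category of $\mathscr{A}$, and call a complex $X^\bullet$ $\mathcal{G}(A)$-acyclic if the complex $\operatorname{Hom}_A(G,X^\bullet)$ is acyclic for every $G\in\mathcal{G}(A)$. Let $D^b_{\mathcal{G}(A)}(\mathscr{A})$ be the Verdier quotient of $K^b(\mathscr{A})$ by its triangulated subcategory of $\mathcal{G}(A)$-acyclic complexes. The bounded homotopy category $K^b(\mathcal{G}(A))$ of complexes with terms in $\mathcal{G}(A)$ is viewed, through the quotient functor, as a full triangulated subcategory of $D^b_{\mathcal{G}(A)}(\mathscr{A})$. If $A$ is Gorenstein, that is, if the injective dimensions of $A$ as a left and as a right module over itself are both finite, then the Gorenstein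 singularity category is zero: $$D_{\mathcal{G}(A)\text{-}sg}(\mathscr{A}) := D^b_{\mathcal{G}(A)}(\mathscr{A})/K^b(\mathcal{G}(A)) = 0,$$ i.e. every object of this Verdier quotient is a zero object. -/

import Mathlib

open CategoryTheory Limits Pretriangulated ZeroObject

universe u

namespace RelativeDerived

section General

variable {C : Type*} [Category* C] [Preadditive C]

/-- The property of objects of the homotopy category `K(C)` of being a bounded complex. -/
def bounded (C : Type*) [Category* C] [Preadditive C] :
    ObjectProperty (HomotopyCategory C (ComplexShape.up ℤ)) :=
  fun K ↦ (∃ a : ℤ, CochainComplex.IsStrictlyGE (C := C) K.as a) ∧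
    ∃ b : ℤ, CochainComplex.IsStrictlyLE (C := C) K.as b

/-- The bounded homotopy category `K^b(C)`. -/
abbrev Kb (C : Type*) [Category* C] [Preadditive C] := (bounded C).FullSubcategory

/-- The `P`-acyclic complexes, as a property of objects of `K(C)`: the complex of abelian
groups `Hom(X, K)` is acyclic for every object `X` in `P`. -/
def acyclic (P : ObjectProperty C) :
    ObjectProperty (HomotopyCategory C (ComplexShape.up ℤ)) :=
  fun K ↦ ∀ X : C, P X → HomotopyCategory.subcategoryAcyclic AddCommGrpCat
    (((preadditiveCoyoneda.obj (Opposite.op X)).mapHomotopyCategory (ComplexShape.up ℤ)).obj K)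

variable [HasBinaryBiproducts C]

lemma isStrictlyLE_mappingCone {K L : CochainComplex C ℤ} (f : K ⟶ L)
    (n₁ n₂ n : ℤ) [K.IsStrictlyLE n₁] [L.IsStrictlyLE n₂] (hn₁ : n₁ ≤ n) (hn₂ : n₂ ≤ n) :
    (CochainComplex.mappingCone f).IsStrictlyLE n := by
  rw [CochainComplex.isStrictlyLE_iff]
  intro i hi
  simp only [CochainComplex.mappingCone.isZero_X_iff]
  exact ⟨K.isZero_of_isStrictlyLE n₁ _, L.isZero_of_isStrictlyLE n₂ _⟩

variable [HasZeroObject C]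

instance : (bounded C).ContainsZero where
  exists_zero := ⟨(HomotopyCategory.quotient C (ComplexShape.up ℤ)).obj 0,
    Functor.map_isZero _ (isZero_zero _), ⟨0, inferInstanceAs
      (CochainComplex.IsStrictlyGE (0 : CochainComplex C ℤ) 0)⟩, ⟨0, inferInstanceAs
      (CochainComplex.IsStrictlyLE (0 : CochainComplex C ℤ) 0)⟩⟩

instance : (bounded C).IsStableUnderShift ℤ where
  isStableUnderShiftBy n :=
    { le_shift K hK := by
        obtain ⟨K : CochainComplex _ _, rfl⟩ := K.quotient_obj_surjective
        obtain ⟨⟨a, ha⟩, ⟨b, hb⟩⟩ := hK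
        rw [ObjectProperty.prop_shift_iff, HomotopyCategory.shift_quotient_obj]
        have ha' : K.IsStrictlyGE a := ha
        have hb' : K.IsStrictlyLE b := hb
        exact ⟨⟨a - n, K.isStrictlyGE_shift a n (a - n) (by lia)⟩,
          ⟨b - n, K.isStrictlyLE_shift b n (b - n) (by lia)⟩⟩ }

set_option maxHeartbeats 400000 in
instance : (bounded C).IsTriangulatedClosed₃ where
  ext₃' T hT h₁ h₂ := by
    obtain ⟨⟨a₁, _⟩, ⟨b₁, _⟩⟩ := h₁
    obtain ⟨⟨a₂, _⟩, ⟨b₂, _⟩⟩ := h₂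
    obtain ⟨f : T.obj₁.as ⟶ T.obj₂.as, hf⟩ :=
      (HomotopyCategory.quotient _ _).map_surjective T.mor₁
    refine ⟨(HomotopyCategory.quotient _ _).obj (CochainComplex.mappingCone f),
      ⟨⟨min (a₁ - 1) a₂, CochainComplex.isStrictlyGE_mappingCone f a₁ a₂ _ (by simp) (by simp)⟩,
        ⟨max b₁ b₂, isStrictlyLE_mappingCone f b₁ b₂ _ (by simp) (by simp)⟩⟩,
      ⟨Triangle.π₃.mapIso (isoTriangleOfIso₁₂ T _ hT
        (HomotopyCategory.mappingCone_triangleh_distinguished f)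
        (Iso.refl _) (Iso.refl _) ?_)⟩⟩
    exact (Category.comp_id _).trans (hf.symm.trans (Category.id_comp _).symm)

instance : (bounded C).IsTriangulated where
  toIsTriangulatedClosed₂ := .of_isTriangulatedClosed₃

instance (P : ObjectProperty C) : (acyclic P).IsClosedUnderIsomorphisms where
  of_iso e h X hX := ObjectProperty.prop_of_iso _
    (Functor.mapIso ((preadditiveCoyoneda.obj (Opposite.op X)).mapHomotopyCategory
      (ComplexShape.up ℤ)) e) (h X hX)

instance (P : ObjectProperty C) : (acyclic P).IsTriangulated where
  exists_zero := ⟨0, isZero_zero _, fun _ _ ↦ ObjectProperty.prop_of_isZero _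
    (Functor.map_isZero _ (isZero_zero _))⟩
  isStableUnderShiftBy n :=
    { le_shift K hK X hX := ((HomotopyCategory.subcategoryAcyclic AddCommGrpCat).inverseImage
        ((preadditiveCoyoneda.obj (Opposite.op X)).mapHomotopyCategory
          (ComplexShape.up ℤ))).le_shift n K (hK X hX) }
  toIsTriangulatedClosed₂ := .mk' fun T hT h₁ h₃ X hX ↦
    ((HomotopyCategory.subcategoryAcyclic AddCommGrpCat).inverseImage
        ((preadditiveCoyoneda.obj (Opposite.op X)).mapHomotopyCategory
          (ComplexShape.up ℤ))).ext_of_isTriangulatedClosed₂ T hT (h₁ X hX) (h₃ X hX)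

/-- The `P`-acyclic objects of `K^b(C)`. -/
abbrev acyclicb (P : ObjectProperty C) : ObjectProperty (Kb C) :=
  (acyclic P).inverseImage (bounded C).ι

/-- The bounded `P`-derived category `D^b_P(C)`: the Verdier quotient of `K^b(C)` by its
triangulated subcategory of `P`-acyclic complexes, that is, the localization of `K^b(C)` at the
morphisms whose cone is `P`-acyclic. -/
abbrev Db (P : ObjectProperty C) := (acyclicb P).trW.Localization

/-- `K^b(P)`, as a full subcategory of `K^b(C)`: the bounded complexes with all terms in `P`. -/
def termwise (P : ObjectProperty C) : ObjectProperty (Kb C) :=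
  fun K ↦ ∀ n : ℤ, P (HomologicalComplex.X (V := C) K.obj.as n)

/-- `K^b(P)`, viewed as a full subcategory of `D^b_P(C)` (closed under isomorphisms):
its essential image under the quotient functor `K^b(C) ⥤ D^b_P(C)`. -/
noncomputable def kbInDb (P : ObjectProperty C) : ObjectProperty (Db P) :=
  (termwise P).map (acyclicb P).trW.Q

/-- The `P`-singularity category: the Verdier quotient `D^b_P(C) / K^b(P)`, that is, the
localization of the triangulated category `D^b_P(C)` at the morphisms whose cone is in `K^b(P)`. -/
abbrev SingularityCategory (P : ObjectProperty C) := (kbInDb P).trW.Localization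

end General

section Modules

instance (A : Type u) [Ring A] : HasZeroObject (FGModuleCat.{u} A) :=
  hasZeroObject_of_hasInitial_object

instance (A : Type u) [Ring A] : HasBinaryBiproducts (FGModuleCat.{u} A) :=
  HasBinaryBiproducts.of_hasBinaryCoproducts

/-- The finitely generated Gorenstein projective left `A`-modules: those isomorphic to
`Im (T⁻¹ → T⁰)` for some exact complex `T` of finitely generated projective modules which remains
exact under `Hom(-, Q)` for every finitely generated projective module `Q`. -/
def gorensteinProjective (A : Type u) [Ring A] : ObjectProperty (FGModuleCat.{u} A) :=
  fun M ↦ ∃ T : CochainComplex (FGModuleCat.{u} A) ℤ,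
    (∀ n : ℤ, Module.Projective A (T.X n)) ∧
    (∀ n : ℤ, Function.Exact (T.d (n - 1) n).hom.hom (T.d n (n + 1)).hom.hom) ∧
    (∀ Q : FGModuleCat.{u} A, Module.Projective A Q → ∀ (n : ℤ) (f : T.X n ⟶ Q),
      T.d (n - 1) n ≫ f = 0 → ∃ g : T.X (n + 1) ⟶ Q, T.d n (n + 1) ≫ g = f) ∧
    Nonempty (M ≃ₗ[A] LinearMap.range (T.d (-1) 0).hom.hom)

/-- `A` is Gorenstein: its injective dimensions as a left and as a right module over itself
(a right module being a left module over the opposite ring) are finite. -/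
def IsGorenstein (A : Type u) [Ring A] : Prop :=
  (∃ n : ℕ, HasInjectiveDimensionLE (ModuleCat.of A A) n) ∧
    ∃ n : ℕ, HasInjectiveDimensionLE (ModuleCat.of Aᵐᵒᵖ A) n

end Modules

end RelativeDerived

/-! The quotient vanishes as soon as every bounded complex receives a map with `G(A)`-acyclic cone
from a bounded complex with Gorenstein projective terms, because `K^b(G(A))` then exhausts the
relative derived category. Brutal truncation reduces this to modules in a single degree, provided
the complexes admitting such a map form a triangulated subcategory. They do: bounded complexes over
`G(A)` are left orthogonal to the acyclic ones, so maps out of them lift along maps with acyclic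
cone (`resolvable_isTriangulated`).

For a single module the work is done with the class of finitely generated `N` such that `Ext^i(N, A)
= 0` for all `i > 0`. Its closure properties are immediate, and only its inclusion in `G(A)` is
needed. Finite injective dimension on the right gives that inclusion: such an `N` is torsionless and
embeds in a finite free module with cokernel in the class (`exists_cosyzygy`), so splicing syzygies
and cosyzygies produces a complete resolution.

Finite injective dimension on the left bounds the degrees where `Ext(M, A)` is nonzero. By induction
on that bound, `M` has an Auslander–Buchweitz approximation `0 → Y → G → M → 0` with `G` in the
class and `Y` of finite projective dimension (`exists_approximation`). Maps from Gorenstein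
projectives lift along epimorphisms with such a kernel (`gorensteinProjective_exists_lift`). Hence
this sequence, and the projective resolution of `Y`, stay exact under `Hom(G', -)` for `G'` in
`G(A)`, and together they resolve `M`. -/

namespace RelativeDerived

/-! ### Relative acyclicity and orthogonality of stalk complexes -/

section Acyclic

variable {C : Type*} [Category* C] [Preadditive C]

lemma acyclic_quotient_obj_iff (P : ObjectProperty C) (K : CochainComplex C ℤ) :
    acyclic P ((HomotopyCategory.quotient C (ComplexShape.up ℤ)).obj K) ↔
      ∀ X : C, P X → ∀ (i j k : ℤ), i + 1 = j → j + 1 = k → ∀ f : X ⟶ K.X j,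
        f ≫ K.d j k = 0 → ∃ g : X ⟶ K.X i, g ≫ K.d i j = f := by
  refine forall_congr' fun X ↦ forall_congr' fun _ ↦ ?_
  have := HomotopyCategory.quotient_obj_mem_subcategoryAcyclic_iff_exactAt
    (((preadditiveCoyoneda.obj (Opposite.op X)).mapHomologicalComplex (ComplexShape.up ℤ)).obj K)
  refine this.trans ⟨fun h i j k hij hjk f hf ↦ ?_, fun h j ↦ ?_⟩
  · have := h j
    rw [HomologicalComplex.exactAt_iff' _ i j k (by simp; lia) (by simp; lia),
      ShortComplex.ab_exact_iff] at this
    exact this f hf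
  · rw [HomologicalComplex.exactAt_iff' _ (j - 1) j (j + 1) (by simp) (by simp),
      ShortComplex.ab_exact_iff]
    exact fun f hf ↦ h (j - 1) j (j + 1) (by lia) rfl f hf

open CochainComplex.HomComplex in
/-- A morphism from a single complex is null-homotopic if it factors through the differential. -/
noncomputable def homotopyZeroOfFac [HasZeroObject C] {X : C} {n m : ℤ} (h : m + 1 = n)
    {K : CochainComplex C ℤ} (f : (CochainComplex.singleFunctor C n).obj X ⟶ K) (y : X ⟶ K.X m)
    (hy : (HomologicalComplex.singleObjXSelf (ComplexShape.up ℤ) n X).hom ≫ y ≫ K.d m n = f.f n) :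
    Homotopy f 0 :=
  (Cochain.equivHomotopy _ _).symm
    ⟨Cochain.fromSingleMk (p := n) (q := m) (n := -1) y (by lia), by
      rw [Cochain.δ_fromSingleMk _ _ 0 n (by lia), Cochain.ofHom_zero, add_zero]
      apply (Cochain.fromSingleEquiv (p := n) (q := n) (by lia)).injective
      rw [Cochain.fromSingleEquiv_fromSingleMk]
      dsimp [Cochain.fromSingleEquiv]
      rw [Cochain.ofHom_v, ← hy]
      exact Iso.inv_hom_id_assoc _ _⟩

/-- A map from `X` placed in degree `n` to `K` is a cocycle of `Hom(X, K)`; acyclicity makes it a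
coboundary, which is exactly a null-homotopy. -/
lemma leftOrthogonal_acyclic_single [HasZeroObject C] {P : ObjectProperty C} {X : C} (hX : P X)
    (n : ℤ) : (acyclic P).leftOrthogonal ((HomotopyCategory.quotient C (ComplexShape.up ℤ)).obj
      ((HomologicalComplex.single C (ComplexShape.up ℤ) n).obj X)) := by
  intro K f hK
  obtain ⟨K, rfl⟩ := HomotopyCategory.quotient_obj_surjective K
  obtain ⟨f, rfl⟩ := (HomotopyCategory.quotient _ _).map_surjective f
  rw [acyclic_quotient_obj_iff] at hK
  obtain ⟨y, hy⟩ := hK X hX (n - 1) n (n + 1) (by lia) rfl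
    ((HomologicalComplex.singleObjXSelf (ComplexShape.up ℤ) n X).inv ≫ f.f n) (by simp)
  rw [← Functor.map_zero]
  exact HomotopyCategory.eq_of_homotopy _ _ (homotopyZeroOfFac (sub_add_cancel n 1) f y
    (by rw [hy, Iso.hom_inv_id_assoc]))

end Acyclic

/-! ### Brutal truncations and dévissage to single degrees -/

section Truncation

variable {C : Type*} [Category* C] [Preadditive C] [HasZeroObject C]

open Classical in
/-- The terms of the brutal truncation of `K` at the degrees satisfying `U`. -/
noncomputable def truncX (K : CochainComplex C ℤ) (U : ℤ → Prop) (n : ℤ) : C :=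
  if U n then K.X n else 0

variable (K : CochainComplex C ℤ) (U : ℤ → Prop)

lemma truncX_eq {n : ℤ} (h : U n) : truncX K U n = K.X n := if_pos h

open Classical in
/-- The inclusion of the terms of the brutal truncation. -/
noncomputable def truncι (n : ℤ) : truncX K U n ⟶ K.X n :=
  if h : U n then eqToHom (truncX_eq K U h) else 0

open Classical in
/-- The projection to the terms of the brutal truncation. -/
noncomputable def truncπ (n : ℤ) : K.X n ⟶ truncX K U n :=
  if h : U n then eqToHom (truncX_eq K U h).symm else 0

lemma isZero_truncX {n : ℤ} (h : ¬ U n) : IsZero (truncX K U n) := by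
  simpa [truncX, h] using isZero_zero C

@[simp]
lemma truncι_truncπ (n : ℤ) : truncι K U n ≫ truncπ K U n = 𝟙 _ := by
  by_cases h : U n
  · simp [truncι, truncπ, h]
  · exact (isZero_truncX K U h).eq_of_src _ _

lemma truncπ_truncι {n : ℤ} (h : U n) : truncπ K U n ≫ truncι K U n = 𝟙 _ := by
  simp [truncι, truncπ, h]

lemma truncι_eq_zero {n : ℤ} (h : ¬ U n) : truncι K U n = 0 := by simp [truncι, h]

lemma truncπ_eq_zero {n : ℤ} (h : ¬ U n) : truncπ K U n = 0 := by simp [truncπ, h]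

lemma truncι_truncπ_not (n : ℤ) : truncι K U n ≫ truncπ K (fun n ↦ ¬ U n) n = 0 := by
  by_cases h : U n
  · rw [truncπ_eq_zero K (fun n ↦ ¬ U n) (not_not.mpr h), comp_zero]
  · rw [truncι_eq_zero K U h, zero_comp]

lemma truncπ_truncι_add_not (n : ℤ) : truncπ K U n ≫ truncι K U n +
    truncπ K (fun n ↦ ¬ U n) n ≫ truncι K (fun n ↦ ¬ U n) n = 𝟙 _ := by
  by_cases h : U n
  · rw [truncπ_truncι K U h, truncπ_eq_zero K (fun n ↦ ¬ U n) (not_not.mpr h), zero_comp, add_zero]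
  · rw [truncπ_truncι K (fun n ↦ ¬ U n) h, truncπ_eq_zero K U h, zero_comp, zero_add]

/-- The brutal truncation of `K` at a convex set of degrees. -/
@[simps]
noncomputable def trunc (hU : ∀ i j k, i ≤ j → j ≤ k → U i → U k → U j) : CochainComplex C ℤ where
  X := truncX K U
  d i j := truncι K U i ≫ K.d i j ≫ truncπ K U j
  shape i j h := by rw [K.shape i j h, zero_comp, comp_zero]
  d_comp_d' i j k hij hjk := by
    by_cases hi : U i
    · by_cases hk : U k
      -- Convexity puts the middle degree in `U`, so the projection followed by the inclusion there
      -- is the identity.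
      · have := truncπ_truncι K U (hU i j k (by simp at hij; lia) (by simp at hjk; lia) hi hk)
        simp only [Category.assoc, reassoc_of% this, K.d_comp_d_assoc, zero_comp, comp_zero]
      · exact (isZero_truncX K U hk).eq_of_tgt _ _
    · exact (isZero_truncX K U hi).eq_of_src _ _

/-- The degreewise split exact sequence of a brutal truncation at degrees `> a`. -/
@[simps]
noncomputable def truncShortComplex (a : ℤ) : ShortComplex (CochainComplex C ℤ) where
  X₁ := trunc K (fun n ↦ a < n) (by lia)
  X₂ := K
  X₃ := trunc K (fun n ↦ ¬ (a < n)) (by lia)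
  f :=
    { f n := truncι K (fun n ↦ a < n) n
      comm' i j hij := by
        by_cases hi : a < i
        · have := truncπ_truncι K (fun n ↦ a < n) (n := j) (by simp at hij; lia)
          change (truncι K (fun n ↦ a < n) i ≫ K.d i j : truncX K _ i ⟶ K.X j) =
            (truncι K (fun n ↦ a < n) i ≫ K.d i j ≫ truncπ K (fun n ↦ a < n) j) ≫
              truncι K (fun n ↦ a < n) j
          rw [Category.assoc, Category.assoc, this, Category.comp_id]
        · exact (isZero_truncX K _ hi).eq_of_src _ _ }
  g :=
    { f n := truncπ K (fun n ↦ ¬ (a < n)) n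
      comm' i j hij := by
        by_cases hj : a < j
        · exact (isZero_truncX K (fun n ↦ ¬ (a < n)) (not_not.mpr hj)).eq_of_tgt _ _
        · have := truncπ_truncι K (fun n ↦ ¬ (a < n)) (n := i) (by simp at hij; lia)
          change (truncπ K (fun n ↦ ¬ (a < n)) i ≫ (truncι K (fun n ↦ ¬ (a < n)) i ≫ K.d i j ≫
            truncπ K (fun n ↦ ¬ (a < n)) j) : K.X i ⟶ truncX K _ j) =
              K.d i j ≫ truncπ K (fun n ↦ ¬ (a < n)) j
          rw [reassoc_of% this] }
  zero := by
    ext n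
    exact truncι_truncπ_not K (fun n ↦ a < n) n

/-- The degreewise splittings of `truncShortComplex`. -/
noncomputable def truncSplitting (a n : ℤ) :
    ((truncShortComplex K a).map (HomologicalComplex.eval C _ n)).Splitting where
  r := truncπ K (fun n ↦ a < n) n
  s := truncι K (fun n ↦ ¬ (a < n)) n
  f_r := truncι_truncπ _ _ _
  s_g := truncι_truncπ _ _ _
  id := truncπ_truncι_add_not K (fun n ↦ a < n) n

variable [HasBinaryBiproducts C]

lemma truncTriangle_distinguished (a : ℤ) :
    CochainComplex.trianglehOfDegreewiseSplit _ (truncSplitting K a) ∈ distTriang _ :=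
  (HomotopyCategory.distinguished_iff_iso_trianglehOfDegreewiseSplit _).2 ⟨_, _, ⟨Iso.refl _⟩⟩

variable {K}

/-- A triangulated subcategory of `K(C)` which contains the objects in `P` placed in a single
degree contains the bounded complexes with terms in `P`. -/
lemma prop_of_isStrictlyGE_of_isStrictlyLE
    (T : ObjectProperty (HomotopyCategory C (ComplexShape.up ℤ))) [T.IsTriangulated]
    [T.IsClosedUnderIsomorphisms] (P : ObjectProperty C) [P.IsClosedUnderIsomorphisms]
    (hT : ∀ (X : C) (n : ℤ), P X → T ((HomotopyCategory.quotient C (ComplexShape.up ℤ)).obj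
      ((HomologicalComplex.single C (ComplexShape.up ℤ) n).obj X)))
    (a b : ℤ) [K.IsStrictlyGE a] [K.IsStrictlyLE b] (hK : ∀ n, a ≤ n → n ≤ b → P (K.X n)) :
    T ((HomotopyCategory.quotient C (ComplexShape.up ℤ)).obj K) := by
  -- The induction is on a bound `m` for the length; `m = 0` leaves no degree between `a` and `b`,
  -- so `K` is zero.
  obtain ⟨m, hm⟩ : ∃ m : ℕ, b < a + m := ⟨(b - a + 1).toNat, by lia⟩
  induction m generalizing a K with
  | zero =>
    refine T.prop_of_isZero (Functor.map_isZero _ ?_)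
    rw [IsZero.iff_id_eq_zero]
    ext n
    by_cases hn : n < a
    · exact (K.isZero_of_isStrictlyGE a n hn).eq_of_src _ _
    · exact (K.isZero_of_isStrictlyLE b n (by lia)).eq_of_src _ _
  | succ m ih =>
    by_cases hab : b < a
    · refine T.prop_of_isZero (Functor.map_isZero _ ?_)
      rw [IsZero.iff_id_eq_zero]
      ext n
      by_cases hn : n < a
      · exact (K.isZero_of_isStrictlyGE a n hn).eq_of_src _ _
      · exact (K.isZero_of_isStrictlyLE b n (by lia)).eq_of_src _ _
    -- The outer terms of the triangle are the truncation to degrees `> a`, which is shorter, and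
    -- the remaining part, concentrated in degree `a`.
    refine T.ext_of_isTriangulatedClosed₂ _ (truncTriangle_distinguished K a) ?_ ?_
    · change T ((HomotopyCategory.quotient C (ComplexShape.up ℤ)).obj
        (trunc K (fun n ↦ a < n) (by lia)))
      have : (trunc K (fun n ↦ a < n) (by lia)).IsStrictlyGE (a + 1) := by
        rw [CochainComplex.isStrictlyGE_iff]
        exact fun n hn ↦ isZero_truncX K (fun n ↦ a < n) (not_lt.2 (Int.lt_add_one_iff.1 hn))
      have : (trunc K (fun n ↦ a < n) (by lia)).IsStrictlyLE b := by
        rw [CochainComplex.isStrictlyLE_iff]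
        intro n hn
        by_cases h : a < n
        · exact (K.isZero_of_isStrictlyLE b n hn).of_iso (eqToIso (truncX_eq K _ h))
        · exact isZero_truncX K _ h
      exact ih (a + 1) (fun n h₁ h₂ ↦ P.prop_of_iso
        (eqToIso (truncX_eq K (fun n ↦ a < n) (Int.lt_of_add_one_le h₁)).symm)
        (hK n (by lia) h₂)) (by push_cast at hm; lia)
    · change T ((HomotopyCategory.quotient C (ComplexShape.up ℤ)).obj
        (trunc K (fun n ↦ ¬ (a < n)) (by lia)))
      have : (trunc K (fun n ↦ ¬ (a < n)) (by lia)).IsStrictlyLE a := by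
        rw [CochainComplex.isStrictlyLE_iff]
        exact fun n hn ↦ isZero_truncX K (fun n ↦ ¬ (a < n)) (not_not.2 hn)
      have : (trunc K (fun n ↦ ¬ (a < n)) (by lia)).IsStrictlyGE a := by
        rw [CochainComplex.isStrictlyGE_iff]
        intro n (hn : n < a)
        exact (K.isZero_of_isStrictlyGE a n hn).of_iso
          (eqToIso (truncX_eq K (fun n ↦ ¬ (a < n)) hn.not_gt))
      obtain ⟨M, ⟨e⟩⟩ := CochainComplex.exists_iso_single (trunc K (fun n ↦ ¬ (a < n)) _) a
      have hM : P M := P.prop_of_iso ((eqToIso (truncX_eq K (fun n ↦ ¬ (a < n)) (n := a)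
        (lt_irrefl a)).symm) ≪≫ (HomologicalComplex.eval C (ComplexShape.up ℤ) a).mapIso e ≪≫
          HomologicalComplex.singleObjXSelf (ComplexShape.up ℤ) a M) (hK a le_rfl (by lia))
      exact T.prop_of_iso ((HomotopyCategory.quotient C (ComplexShape.up ℤ)).mapIso e.symm)
        (hT M a hM)

end Truncation

/-! ### Complexes resolved by bounded complexes over a subclass -/

section Resolvable

variable {C : Type*} [Category* C] [Preadditive C]

/-- The bounded complexes with terms in `P`, as a property of objects of `K(C)`. -/
def boundedTermwise (P : ObjectProperty C) :
    ObjectProperty (HomotopyCategory C (ComplexShape.up ℤ)) :=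
  fun K ↦ bounded C K ∧ ∀ n : ℤ, P (HomologicalComplex.X (V := C) K.as n)

lemma boundedTermwise_shift {P : ObjectProperty C}
    {K : HomotopyCategory C (ComplexShape.up ℤ)} (hK : boundedTermwise P K) (n : ℤ) :
    boundedTermwise P (K⟦n⟧) := by
  refine ⟨(bounded C).le_shift n _ hK.1, ?_⟩
  obtain ⟨K : CochainComplex _ _, rfl⟩ := K.quotient_obj_surjective
  rw [HomotopyCategory.shift_quotient_obj]
  exact fun i ↦ hK.2 _

variable [HasZeroObject C] [HasBinaryBiproducts C]

/-- The left orthogonal is a triangulated subcategory, so dévissage reduces the claim to single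
objects. -/
lemma boundedTermwise_le_leftOrthogonal {P P' : ObjectProperty C} [P'.IsClosedUnderIsomorphisms]
    (h : P' ≤ P) : boundedTermwise P' ≤ (acyclic P).leftOrthogonal := by
  intro K hK
  obtain ⟨K : CochainComplex _ _, rfl⟩ := K.quotient_obj_surjective
  obtain ⟨⟨⟨a, ha⟩, ⟨b, hb⟩⟩, hK⟩ := hK
  have ha' : K.IsStrictlyGE a := ha
  have hb' : K.IsStrictlyLE b := hb
  exact prop_of_isStrictlyGE_of_isStrictlyLE _ P'
    (fun X n hX ↦ leftOrthogonal_acyclic_single (h _ hX) n) a b (fun n _ _ ↦ hK n)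

lemma exists_distinguished_of_boundedTermwise {P : ObjectProperty C}
    [P.IsClosedUnderIsomorphisms] (hP : ∀ X Y, P X → P Y → P (X ⊞ Y))
    {K L : HomotopyCategory C (ComplexShape.up ℤ)} (f : K ⟶ L)
    (hK : boundedTermwise P K) (hL : boundedTermwise P L) :
    ∃ (M : HomotopyCategory C (ComplexShape.up ℤ)) (g : L ⟶ M) (h : M ⟶ K⟦(1 : ℤ)⟧),
      boundedTermwise P M ∧ Triangle.mk f g h ∈ distTriang _ := by
  obtain ⟨K : CochainComplex _ _, rfl⟩ := K.quotient_obj_surjective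
  obtain ⟨L : CochainComplex _ _, rfl⟩ := L.quotient_obj_surjective
  obtain ⟨f : K ⟶ L, rfl⟩ := (HomotopyCategory.quotient _ _).map_surjective f
  obtain ⟨⟨⟨a₁, ha₁⟩, ⟨b₁, hb₁⟩⟩, hK⟩ := hK
  obtain ⟨⟨⟨a₂, ha₂⟩, ⟨b₂, hb₂⟩⟩, hL⟩ := hL
  have : K.IsStrictlyGE a₁ := ha₁
  have : K.IsStrictlyLE b₁ := hb₁
  have : L.IsStrictlyGE a₂ := ha₂
  have : L.IsStrictlyLE b₂ := hb₂
  refine ⟨(HomotopyCategory.quotient _ _).obj (CochainComplex.mappingCone f), _, _, ⟨⟨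
    ⟨min (a₁ - 1) a₂, CochainComplex.isStrictlyGE_mappingCone f a₁ a₂ _ (by simp) (by simp)⟩,
    ⟨max b₁ b₂, isStrictlyLE_mappingCone f b₁ b₂ _ (by simp) (by simp)⟩⟩, fun n ↦ ?_⟩,
    HomotopyCategory.mappingCone_triangleh_distinguished f⟩
  exact P.prop_of_iso (HomologicalComplex.homotopyCofiber.XIsoBiprod f n (n + 1) rfl).symm
    (hP _ _ (hK _) (hL _))

/-- The objects `K` of `K(C)` for which there is a morphism `L ⟶ K` with `P`-acyclic cone from
a bounded complex `L` with terms in `P'`. -/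
def resolvable (P P' : ObjectProperty C) :
    ObjectProperty (HomotopyCategory C (ComplexShape.up ℤ)) :=
  fun K ↦ ∃ (L : HomotopyCategory C (ComplexShape.up ℤ)) (f : L ⟶ K),
    boundedTermwise P' L ∧ (acyclic P).trW f

variable (P P' : ObjectProperty C)

instance : (resolvable P P').IsClosedUnderIsomorphisms where
  of_iso e := by
    rintro ⟨L, f, hL, hf⟩
    exact ⟨L, f ≫ e.hom, hL, MorphismProperty.RespectsIso.postcomp _ _ _ hf⟩

variable {P P'} in
lemma resolvable_of_trW {K K' : HomotopyCategory C (ComplexShape.up ℤ)} (g : K ⟶ K')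
    (hg : (acyclic P).trW g) (hK : resolvable P P' K) : resolvable P P' K' := by
  obtain ⟨L, f, hL, hf⟩ := hK
  exact ⟨L, f ≫ g, hL, MorphismProperty.comp_mem _ _ _ hf hg⟩

variable {P P'} in
-- For cones, a map between resolvable objects is lifted to their resolutions; the cone of the lift
-- still has terms in `P'`, and the induced map of triangles has `P`-acyclic cone on the third
-- vertex.
lemma resolvable_isTriangulated [P'.IsClosedUnderIsomorphisms] (h : P' ≤ P) (h₀ : P' 0)
    (hP' : ∀ X Y, P' X → P' Y → P' (X ⊞ Y)) : (resolvable P P').IsTriangulated := by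
  have : (resolvable P P').ContainsZero :=
    { exists_zero := by
        refine ⟨(HomotopyCategory.quotient C (ComplexShape.up ℤ)).obj 0,
          Functor.map_isZero _ (isZero_zero _), _, 𝟙 _, ⟨⟨⟨0, inferInstanceAs
          (CochainComplex.IsStrictlyGE (0 : CochainComplex C ℤ) 0)⟩, ⟨0, inferInstanceAs
          (CochainComplex.IsStrictlyLE (0 : CochainComplex C ℤ) 0)⟩⟩, fun n ↦ ?_⟩, MorphismProperty.id_mem _ _⟩
        exact P'.prop_of_iso ((isZero_zero C).iso
          (Functor.map_isZero (HomologicalComplex.eval C (ComplexShape.up ℤ) n)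
            (isZero_zero (HomologicalComplex C (ComplexShape.up ℤ))))) h₀ }
  have : (resolvable P P').IsStableUnderShift ℤ :=
    { isStableUnderShiftBy n :=
        { le_shift K := by
            rintro ⟨L, f, hL, hf⟩
            exact ⟨L⟦n⟧, f⟦n⟧', boundedTermwise_shift hL n, ObjectProperty.trW.shift hf n⟩ } }
  have : (resolvable P P').IsTriangulatedClosed₃ := .mk' (by
    rintro T hT ⟨L₁, f₁, hL₁, hf₁⟩ ⟨L₂, f₂, hL₂, hf₂⟩
    -- Left orthogonality makes `L₁` colocal: composing with `f₂` is bijective on maps out of `L₁`,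
    -- which yields the lift `α`.
    have hL₁' := boundedTermwise_le_leftOrthogonal h _ hL₁
    rw [← ObjectProperty.isColocal_trW] at hL₁'
    obtain ⟨α, hα⟩ := (hL₁' _ hf₂).2 (f₁ ≫ T.mor₁)
    obtain ⟨L₃, g, k, hL₃, hT'⟩ := exists_distinguished_of_boundedTermwise hP' α hL₁ hL₂
    obtain ⟨c, hc, -⟩ := MorphismProperty.compatible_with_triangulation (W := (acyclic P).trW)
      _ _ hT' hT f₁ f₂ hf₁ hf₂ hα
    exact ⟨L₃, c, hL₃, hc⟩)
  have : (resolvable P P').IsTriangulatedClosed₂ := .of_isTriangulatedClosed₃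
  exact { }

end Resolvable

/-! ### Relatively exact sequences give relative equivalences from cones -/

section ShortExact

variable {C : Type*} [Category* C] [Preadditive C] [HasBinaryBiproducts C]

open CochainComplex HomComplex

/-- The canonical morphism from the mapping cone of `S.f` to `S.X₃`. -/
noncomputable def coneDesc (S : ShortComplex (CochainComplex C ℤ)) :
    mappingCone S.f ⟶ S.X₃ := mappingCone.desc S.f 0 S.g (by simp)

/-- `C` is not assumed abelian; this transports `coneDesc` to an abelian target, where the
comparison map of a short exact sequence is a quasi-isomorphism. -/
lemma map_coneDesc {D : Type*} [Category* D] [Abelian D] (F : C ⥤ D) [F.Additive]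
    (S : ShortComplex (CochainComplex C ℤ)) :
    (F.mapHomologicalComplex (.up ℤ)).map (coneDesc S) =
      (mappingCone.mapHomologicalComplexIso _ _).hom ≫
        mappingCone.descShortComplex (S.map (F.mapHomologicalComplex (.up ℤ))) := by
  ext n
  have h₁ := mappingCone.inl_v_descShortComplex_f (S.map (F.mapHomologicalComplex (.up ℤ)))
    (n + 1) n (by lia)
  have h₂ := mappingCone.inr_f_descShortComplex_f (S.map (F.mapHomologicalComplex (.up ℤ))) n
  refine Eq.trans ?_ (Preadditive.add_comp _ _ _
    (F.map ((mappingCone.fst S.f).1.v n (n + 1) rfl) ≫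
      (mappingCone.inl ((F.mapHomologicalComplex (.up ℤ)).map S.f)).v (n + 1) n (by lia))
    (F.map ((mappingCone.snd S.f).v n n (add_zero n)) ≫
      (mappingCone.inr ((F.mapHomologicalComplex (.up ℤ)).map S.f)).f n)
    ((mappingCone.descShortComplex (S.map (F.mapHomologicalComplex (.up ℤ)))).f n)).symm
  refine Eq.trans ?_ (congrArg₂ (· + ·)
    ((Category.assoc _ _ _).trans ((congrArg (F.map _ ≫ ·) h₁).trans Limits.comp_zero))
    ((Category.assoc _ _ _).trans (congrArg (F.map _ ≫ ·) h₂))).symm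
  refine Eq.trans ?_ (zero_add _).symm
  refine Eq.trans ?_ (F.map_comp _ _)
  refine congrArg F.map ?_
  simp [coneDesc, mappingCone.desc_f _ _ _ _ n (n + 1) rfl]

variable [HasZeroObject C]

lemma trW_acyclic_iff (P : ObjectProperty C) {K L : CochainComplex C ℤ} (f : K ⟶ L) :
    (acyclic P).trW ((HomotopyCategory.quotient C (ComplexShape.up ℤ)).map f) ↔
      ∀ X : C, P X → QuasiIso (((preadditiveCoyoneda.obj (Opposite.op X)).mapHomologicalComplex
        (ComplexShape.up ℤ)).map f) := by
  refine ((acyclic P).trW_iff_of_distinguished _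
    (HomotopyCategory.mappingCone_triangleh_distinguished f)).trans
      (forall_congr' fun X ↦ forall_congr' fun _ ↦ ?_)
  rw [← HomologicalComplex.mem_quasiIso_iff, ← HomotopyCategory.quotient_map_mem_quasiIso_iff,
    HomotopyCategory.quasiIso_eq_trW_subcategoryAcyclic]
  refine (((HomotopyCategory.subcategoryAcyclic AddCommGrpCat).inverseImage
    ((preadditiveCoyoneda.obj (Opposite.op X)).mapHomotopyCategory
      (ComplexShape.up ℤ))).trW_iff_of_distinguished _
        (HomotopyCategory.mappingCone_triangleh_distinguished f)).symm.trans ?_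
  exact ObjectProperty.inverseImage_trW_iff _ _ _

lemma trW_coneDesc_single (P : ObjectProperty C) (S : ShortComplex C)
    (hS : ∀ X : C, P X → (S.map (preadditiveCoyoneda.obj (Opposite.op X))).ShortExact) (n : ℤ) :
    (acyclic P).trW ((HomotopyCategory.quotient C (ComplexShape.up ℤ)).map
      (coneDesc (S.map (HomologicalComplex.single C (ComplexShape.up ℤ) n)))) := by
  rw [trW_acyclic_iff]
  intro X hX
  rw [map_coneDesc]
  have : QuasiIso (mappingCone.descShortComplex
    ((S.map (HomologicalComplex.single C (ComplexShape.up ℤ) n)).map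
      ((preadditiveCoyoneda.obj (Opposite.op X)).mapHomologicalComplex (ComplexShape.up ℤ)))) := by
    refine mappingCone.quasiIso_descShortComplex ?_
    refine ShortComplex.shortExact_of_iso (ShortComplex.mapNatIso S
      (HomologicalComplex.singleMapHomologicalComplex _ _ _).symm) ?_
    exact (hS X hX).map_of_exact (HomologicalComplex.single AddCommGrpCat (ComplexShape.up ℤ) n)
  have hiso : QuasiIso (mappingCone.mapHomologicalComplexIso
    (S.map (HomologicalComplex.single C (ComplexShape.up ℤ) n)).f
      (preadditiveCoyoneda.obj (Opposite.op X))).hom := quasiIso_of_isIso _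
  exact quasiIso_comp (hφ := hiso) (hφ' := this) _ _

/-- Up to a map with acyclic cone, `S.X₃` is the cone of `S.f`, and resolvable objects are closed
under cones. -/
lemma resolvable_single_of_shortExact {P P' : ObjectProperty C} [P'.IsClosedUnderIsomorphisms]
    (h : P' ≤ P) (h₀ : P' 0) (hP' : ∀ X Y, P' X → P' Y → P' (X ⊞ Y)) (S : ShortComplex C)
    (hS : ∀ X : C, P X → (S.map (preadditiveCoyoneda.obj (Opposite.op X))).ShortExact) (n : ℤ)
    (h₁ : resolvable P P' ((HomotopyCategory.quotient C (ComplexShape.up ℤ)).obj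
      ((HomologicalComplex.single C (ComplexShape.up ℤ) n).obj S.X₁)))
    (h₂ : resolvable P P' ((HomotopyCategory.quotient C (ComplexShape.up ℤ)).obj
      ((HomologicalComplex.single C (ComplexShape.up ℤ) n).obj S.X₂))) :
    resolvable P P' ((HomotopyCategory.quotient C (ComplexShape.up ℤ)).obj
      ((HomologicalComplex.single C (ComplexShape.up ℤ) n).obj S.X₃)) := by
  have := resolvable_isTriangulated h h₀ hP'
  refine resolvable_of_trW _ (trW_coneDesc_single P S hS n) ?_
  exact (resolvable P P').ext_of_isTriangulatedClosed₃ _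
    (HomotopyCategory.mappingCone_triangleh_distinguished
      ((HomologicalComplex.single C (ComplexShape.up ℤ) n).map S.f)) h₁ h₂

lemma resolvable_single {P P' : ObjectProperty C} {X : C} (h₀ : P' 0)
    [P'.IsClosedUnderIsomorphisms] (hX : P' X) (n : ℤ) :
    resolvable P P' ((HomotopyCategory.quotient C (ComplexShape.up ℤ)).obj
      ((HomologicalComplex.single C (ComplexShape.up ℤ) n).obj X)) := by
  refine ⟨_, 𝟙 _, ⟨⟨⟨n, ?_⟩, ⟨n, ?_⟩⟩, fun i ↦ ?_⟩, MorphismProperty.id_mem _ _⟩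
  · exact inferInstanceAs (IsStrictlyGE
      ((HomologicalComplex.single C (ComplexShape.up ℤ) n).obj X) n)
  · exact inferInstanceAs (IsStrictlyLE
      ((HomologicalComplex.single C (ComplexShape.up ℤ) n).obj X) n)
  · by_cases hi : i = n
    · subst hi
      exact P'.prop_of_iso (HomologicalComplex.singleObjXSelf _ i X).symm hX
    · exact P'.prop_of_iso ((isZero_zero C).iso
        (HomologicalComplex.isZero_single_obj_X _ _ _ _ hi)) h₀

end ShortExact

/-! ### Vanishing of the singularity category -/

section SingularityCategory

variable {C : Type*} [Category* C] [Preadditive C] [HasZeroObject C] [HasBinaryBiproducts C]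

lemma isZero_singularityCategory_of_resolvable {P P' : ObjectProperty C}
    [P'.IsClosedUnderIsomorphisms]
    (h : P' ≤ P) (h₀ : P' 0) (hP' : ∀ X Y, P' X → P' Y → P' (X ⊞ Y))
    (hC : ∀ X : C, resolvable P P' ((HomotopyCategory.quotient C (ComplexShape.up ℤ)).obj
      ((HomologicalComplex.single C (ComplexShape.up ℤ) 0).obj X)))
    (X : SingularityCategory P) : IsZero X := by
  have := resolvable_isTriangulated h h₀ hP'
  have hC' (X : C) (n : ℤ) : resolvable P P'
      ((HomotopyCategory.quotient C (ComplexShape.up ℤ)).obj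
        ((HomologicalComplex.single C (ComplexShape.up ℤ) n).obj X)) := by
    -- The stalk in degree `n` is the shift by `-n` of the stalk in degree `0`.
    refine (resolvable P P').prop_of_iso
      (((HomotopyCategory.quotient C (ComplexShape.up ℤ)).commShiftIso (-n)).symm.app _ ≪≫
        (HomotopyCategory.quotient C (ComplexShape.up ℤ)).mapIso
          (((CochainComplex.singleFunctors C).shiftIso (-n) n 0 (by simp)).app X))
      ((resolvable P P').le_shift (-n) _ (hC X))
  have htop : kbInDb P = ⊤ := by
    rw [eq_top_iff]
    intro Y _
    obtain ⟨K, ⟨e⟩⟩ : ∃ K, Nonempty ((acyclicb P).trW.Q.obj K ≅ Y) :=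
      ⟨_, ⟨(acyclicb P).trW.Q.objObjPreimageIso Y⟩⟩
    have hK : resolvable P P' K.obj := by
      obtain ⟨K, hK⟩ := K
      obtain ⟨K : CochainComplex _ _, rfl⟩ := K.quotient_obj_surjective
      obtain ⟨⟨a, ha⟩, ⟨b, hb⟩⟩ := hK
      have : K.IsStrictlyGE a := ha
      have : K.IsStrictlyLE b := hb
      exact prop_of_isStrictlyGE_of_isStrictlyLE _ ⊤ (fun X n _ ↦ hC' X n) a b
        (fun _ _ _ ↦ trivial)
    obtain ⟨L, f, hL, hf⟩ := hK
    let L' : Kb C := ⟨L, hL.1⟩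
    let f' : L' ⟶ K := ObjectProperty.homMk f
    have hf' : (acyclicb P).trW f' :=
      (ObjectProperty.inverseImage_trW_iff (acyclic P) (bounded C).ι f').2 hf
    have := Localization.inverts (acyclicb P).trW.Q (acyclicb P).trW f' hf'
    exact ⟨_, (fun n ↦ h _ (hL.2 n) : termwise P L'),
      ⟨asIso ((acyclicb P).trW.Q.map f') ≪≫ e⟩⟩
  have hall (Y : Db P) : kbInDb P Y := by
    rw [htop]
    trivial
  -- Nothing is assumed about closure properties of `P`; the subcategory is triangulated here
  -- because it is everything.
  have : (kbInDb P).IsTriangulated := by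
    rw [htop]
    exact { exists_zero := ⟨0, isZero_zero _, trivial⟩
            isStableUnderShiftBy _ := { le_shift _ _ := trivial }
            toIsTriangulatedClosed₂ := .mk' fun _ _ _ _ ↦ trivial }
  -- The cone of `0 ⟶ Y` is `Y`, which lies in `kbInDb P`, so the quotient identifies `Y` with `0`.
  have hX : IsIso ((kbInDb P).trW.Q.map (0 : 0 ⟶ (kbInDb P).trW.Q.objPreimage X)) :=
    Localization.inverts (kbInDb P).trW.Q (kbInDb P).trW _
      (ObjectProperty.trW.mk _ (contractible_distinguished₁ _) (hall _))
  exact (Functor.map_isZero (kbInDb P).trW.Q (isZero_zero _)).of_iso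
    (asIso ((kbInDb P).trW.Q.map (0 : 0 ⟶ (kbInDb P).trW.Q.objPreimage X)) ≪≫
      (kbInDb P).trW.Q.objObjPreimageIso X).symm

end SingularityCategory

/-! ### Dimension shifting for `Ext(-, E)` -/

section ExtVanishing

variable {R : Type u} [Ring R]

/-- The vanishing of `Ext^i(N, E)` for all `i > m`. -/
def ExtVanishing (E : Type u) [AddCommGroup E] [Module R E] (m : ℕ) (N : Type u) [AddCommGroup N]
    [Module R N] : Prop :=
  ∀ i, m < i → Subsingleton (Abelian.Ext (ModuleCat.of R N) (ModuleCat.of R E) i)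

variable {E : Type u} [AddCommGroup E] [Module R E]
variable {N P M : Type u} [AddCommGroup N] [Module R N] [AddCommGroup P] [Module R P]
  [AddCommGroup M] [Module R M]

lemma extVanishing_of_projective [Module.Projective R P] (m : ℕ) :
    ExtVanishing (R := R) E m P := by
  intro i hi
  have : Projective (ModuleCat.of R P) := (IsProjective.iff_projective P).1 inferInstance
  exact HasProjectiveDimensionLT.subsingleton _ 1 i (by lia) _

lemma ExtVanishing.of_equiv {m : ℕ} (h : ExtVanishing (R := R) E m N) (e : N ≃ₗ[R] M) :
    ExtVanishing (R := R) E m M := by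
  intro i hi
  have : Subsingleton (((Abelian.extFunctor i).obj (Opposite.op (ModuleCat.of R N))).obj
    (ModuleCat.of R E)) := h i hi
  exact (((Abelian.extFunctor i).mapIso e.toModuleIso.op).app
    (ModuleCat.of R E)).addCommGroupIsoToAddEquiv.injective.subsingleton

variable {f : N →ₗ[R] P} {g : P →ₗ[R] M} (hf : Function.Injective f) (hfg : Function.Exact f g)
  (hg : Function.Surjective g)

/-- The short complex in `ModuleCat R` attached to an exact pair of linear maps. -/
abbrev shortComplexOfExact (hfg : Function.Exact f g) : ShortComplex (ModuleCat.{u} R) :=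
  ShortComplex.mk (ModuleCat.ofHom f) (ModuleCat.ofHom g) (by
    ext x
    exact hfg.apply_apply_eq_zero x)

include hf hg in
lemma shortExact_shortComplexOfExact : (shortComplexOfExact hfg).ShortExact :=
  ModuleCat.shortComplex_shortExact _ hfg hf hg

include hf hfg hg

lemma ExtVanishing.middle {m : ℕ} (h₁ : ExtVanishing (R := R) E m N)
    (h₃ : ExtVanishing (R := R) E m M) : ExtVanishing (R := R) E m P := by
  intro i hi
  have hS := shortExact_shortComplexOfExact hf hfg hg
  refine subsingleton_of_forall_eq 0 fun x ↦ ?_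
  obtain ⟨y, hy⟩ := Abelian.Ext.contravariant_sequence_exact₂ hS (ModuleCat.of R E) x
    ((h₁ i hi).elim _ _)
  rw [← hy, (h₃ i hi).elim y 0, Abelian.Ext.comp_zero]

lemma ExtVanishing.left {m : ℕ} (h₂ : ExtVanishing (R := R) E m P)
    (h₃ : ExtVanishing (R := R) E (m + 1) M) : ExtVanishing (R := R) E m N := by
  intro i hi
  have hS := shortExact_shortComplexOfExact hf hfg hg
  refine subsingleton_of_forall_eq 0 fun x ↦ ?_
  obtain ⟨y, hy⟩ := Abelian.Ext.contravariant_sequence_exact₁ hS (ModuleCat.of R E) x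
    (add_comm 1 i) ((h₃ (i + 1) (by lia)).elim _ _)
  rw [← hy, (h₂ i hi).elim y 0, Abelian.Ext.comp_zero]

lemma ExtVanishing.right {m : ℕ} (h₁ : ExtVanishing (R := R) E m N)
    (h₂ : ExtVanishing (R := R) E (m + 1) P) : ExtVanishing (R := R) E (m + 1) M := by
  intro i hi
  have hS := shortExact_shortComplexOfExact hf hfg hg
  refine subsingleton_of_forall_eq 0 fun x ↦ ?_
  obtain ⟨j, rfl⟩ : ∃ j, i = 1 + j := ⟨i - 1, by lia⟩
  obtain ⟨y, hy⟩ := Abelian.Ext.contravariant_sequence_exact₃ hS (ModuleCat.of R E) x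
    ((h₂ (1 + j) hi).elim _ _) rfl
  rw [← hy, (h₁ j (by lia)).elim y 0, Abelian.Ext.comp_zero]

lemma ExtVanishing.exists_extension (h : ExtVanishing (R := R) E 0 M) (φ : N →ₗ[R] E) :
    ∃ ψ : P →ₗ[R] E, ψ ∘ₗ f = φ := by
  have hS := shortExact_shortComplexOfExact hf hfg hg
  obtain ⟨y, hy⟩ := Abelian.Ext.contravariant_sequence_exact₁ hS (ModuleCat.of R E)
    (Abelian.Ext.mk₀ (ModuleCat.ofHom φ)) (add_comm 1 0) ((h 1 zero_lt_one).elim _ _)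
  obtain ⟨ψ, rfl⟩ := Abelian.Ext.addEquiv₀.symm.surjective y
  rw [Abelian.Ext.addEquiv₀_symm_apply, Abelian.Ext.mk₀_comp_mk₀] at hy
  exact ⟨ψ.hom, congrArg ModuleCat.Hom.hom
    (Abelian.Ext.addEquiv₀.symm.injective (a₁ := ModuleCat.ofHom f ≫ ψ) hy)⟩

/-- As `P` is projective, every class in `Ext^1(M, E)` comes from some `φ : N → E` by the connecting
map, which kills the maps that extend to `P`. Dimension shifting only reaches degrees above one,
hence the separate case. -/
lemma ExtVanishing.of_exists_extension [Module.Projective R P]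
    (h₁ : ExtVanishing (R := R) E 0 N)
    (h : ∀ φ : N →ₗ[R] E, ∃ ψ : P →ₗ[R] E, ψ ∘ₗ f = φ) : ExtVanishing (R := R) E 0 M := by
  intro i hi
  by_cases hi' : i = 1
  · subst hi'
    have hS := shortExact_shortComplexOfExact hf hfg hg
    refine subsingleton_of_forall_eq 0 fun x ↦ ?_
    obtain ⟨y, hy⟩ := Abelian.Ext.contravariant_sequence_exact₃ hS (ModuleCat.of R E) x
      ((extVanishing_of_projective 0 1 zero_lt_one).elim _ _) (add_zero 1)
    obtain ⟨φ, rfl⟩ := Abelian.Ext.addEquiv₀.symm.surjective y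
    obtain ⟨ψ, hψ⟩ := h φ.hom
    have hφ : φ = ModuleCat.ofHom f ≫ ModuleCat.ofHom ψ := by
      ext x
      exact (LinearMap.congr_fun hψ x).symm
    rw [← hy, Abelian.Ext.addEquiv₀_symm_apply, hφ, ← Abelian.Ext.mk₀_comp_mk₀,
      hS.extClass_comp_assoc]
  · exact ExtVanishing.right hf hfg hg h₁ (extVanishing_of_projective 1) i (by lia)

/-- `Q` is a direct summand of a finite free module: extend each coordinate, then retract. -/
lemma ExtVanishing.exists_extension_projective (h : ExtVanishing (R := R) R 0 M) {Q : Type*}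
    [AddCommGroup Q] [Module R Q] [Module.Finite R Q] [Module.Projective R Q] (φ : N →ₗ[R] Q) :
    ∃ ψ : P →ₗ[R] Q, ψ ∘ₗ f = φ := by
  obtain ⟨n, s, r, -, -, hsr⟩ := Module.Finite.exists_comp_eq_id_of_projective R Q
  choose ψ hψ using fun i ↦ h.exists_extension hf hfg hg (LinearMap.proj i ∘ₗ r ∘ₗ φ)
  refine ⟨s ∘ₗ LinearMap.pi ψ, ?_⟩
  have : LinearMap.pi ψ ∘ₗ f = r ∘ₗ φ := by
    ext x i
    exact LinearMap.congr_fun (hψ i) x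
  rw [LinearMap.comp_assoc, this, ← LinearMap.comp_assoc, hsr, LinearMap.id_comp]

end ExtVanishing

/-- A linear map vanishing on the kernel of a surjective map factors through it. -/
lemma exists_factor_of_exact {R : Type*} [Ring R] {N P M L : Type*} [AddCommGroup N] [Module R N]
    [AddCommGroup P] [Module R P] [AddCommGroup M] [Module R M] [AddCommGroup L] [Module R L]
    {f : N →ₗ[R] P} {g : P →ₗ[R] M} (hfg : Function.Exact f g) (hg : Function.Surjective g)
    (φ : P →ₗ[R] L) (hφ : φ ∘ₗ f = 0) : ∃ ψ : M →ₗ[R] L, ψ ∘ₗ g = φ := by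
  have h : LinearMap.ker g ≤ LinearMap.ker φ := by
    rw [hfg.linearMap_ker_eq]
    exact LinearMap.range_le_ker_iff.2 hφ
  refine ⟨(LinearMap.ker g).liftQ φ h ∘ₗ (g.quotKerEquivOfSurjective hg).symm, ?_⟩
  ext x
  have : (g.quotKerEquivOfSurjective hg).symm (g x) = Submodule.Quotient.mk x := by
    rw [LinearEquiv.symm_apply_eq]
    rfl
  simp [this]

/-! ### Duality between left and right modules -/

section Dual

variable {A : Type u} [Ring A]

/-- The free module of rank one over the opposite ring. -/
def opLinearEquivSelf : A ≃ₗ[Aᵐᵒᵖ] Aᵐᵒᵖ where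
  toFun := MulOpposite.op
  invFun := MulOpposite.unop
  map_add' _ _ := rfl
  map_smul' _ _ := rfl

instance : Module.Free Aᵐᵒᵖ A := Module.Free.of_equiv (opLinearEquivSelf (A := A)).symm

variable {M N P : Type u} [AddCommGroup M] [Module A M] [AddCommGroup N] [Module A N]
  [AddCommGroup P] [Module A P]

/-- The transpose of a linear map, as a linear map between the dual right modules. -/
def rightDualMap (f : M →ₗ[A] N) : (N →ₗ[A] A) →ₗ[Aᵐᵒᵖ] (M →ₗ[A] A) where
  toFun φ := φ ∘ₗ f
  map_add' _ _ := rfl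
  map_smul' _ _ := rfl

/-- The evaluation at an element, as a linear form on the dual right module. -/
def rightDualEval (x : M) : (M →ₗ[A] A) →ₗ[Aᵐᵒᵖ] A where
  toFun φ := φ x
  map_add' _ _ := rfl
  map_smul' _ _ := rfl

lemma rightDualMap_injective {f : M →ₗ[A] N} (hf : Function.Surjective f) :
    Function.Injective (rightDualMap f) := by
  intro φ ψ h
  ext y
  obtain ⟨x, rfl⟩ := hf y
  exact LinearMap.congr_fun h x

lemma rightDualMap_exact {f : M →ₗ[A] N} {g : N →ₗ[A] P} (hfg : Function.Exact f g)
    (hg : Function.Surjective g) : Function.Exact (rightDualMap g) (rightDualMap f) := by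
  intro φ
  constructor
  · intro h
    exact exists_factor_of_exact hfg hg φ h
  · rintro ⟨ψ, rfl⟩
    ext x
    exact (congrArg ψ (hfg.apply_apply_eq_zero x)).trans (map_zero ψ)

/-- The coordinate forms generate the dual as a right module, so a form `θ` is evaluation at the
vector of its values on them. -/
lemma rightDualEval_surjective (n : ℕ) :
    Function.Surjective (rightDualEval (A := A) (M := Fin n → A)) := by
  intro θ
  refine ⟨fun i ↦ θ (LinearMap.proj i), ?_⟩
  ext φ
  have hφ : φ = ∑ i, MulOpposite.op (φ (Pi.single i 1)) • (LinearMap.proj i) := by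
    refine LinearMap.pi_ext' fun i ↦ LinearMap.ext_ring ?_
    simp [Pi.single_apply]
  conv_rhs => rw [hφ, map_sum]
  conv_lhs => rw [hφ]
  simp [rightDualEval]

lemma eq_of_forall_linearForm {n : ℕ} {x y : Fin n → A}
    (h : ∀ φ : (Fin n → A) →ₗ[A] A, φ x = φ y) : x = y :=
  funext fun i ↦ h (LinearMap.proj i)

/-! ### Torsionlessness and cosyzygies from right injective dimension -/

section Gorenstein

lemma surjective_rightDualMap_of_extVanishing {f : M →ₗ[A] N} {g : N →ₗ[A] P}
    (hf : Function.Injective f) (hfg : Function.Exact f g) (hg : Function.Surjective g)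
    (h : ExtVanishing (R := A) A 0 P) : Function.Surjective (rightDualMap f) :=
  fun φ ↦ h.exists_extension hf hfg hg φ

instance (n : ℕ) : Module.Free Aᵐᵒᵖ ((Fin n → A) →ₗ[A] A) :=
  Module.Free.of_equiv ((Pi.basisFun A (Fin n)).constr Aᵐᵒᵖ)

variable [IsNoetherianRing A]

/-- Over a left noetherian ring, every finitely generated module is a quotient of a free module
of finite rank by a finitely generated submodule. -/
lemma exists_finite_presentation (N : Type u) [AddCommGroup N] [Module A N] [Module.Finite A N] :
    ∃ (K : FGModuleCat.{u} A) (n : ℕ) (f : K →ₗ[A] (Fin n → A)) (g : (Fin n → A) →ₗ[A] N),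
      Function.Injective f ∧ Function.Exact f g ∧ Function.Surjective g := by
  obtain ⟨n, g, hg⟩ := Module.Finite.exists_fin' A N
  exact ⟨FGModuleCat.of A (LinearMap.ker g), n, (LinearMap.ker g).subtype, g,
    (LinearMap.ker g).injective_subtype, LinearMap.exact_subtype_ker_map g, hg⟩

/-- Dualizing `0 → K → F → N → 0` stays exact, so vanishing above `m + 1` for the dual of the syzygy
`K` gives vanishing above `m` for the dual of `N`. Going down from `m = n`, where the injective
dimension applies, requires the claim for all `N` at once. -/
lemma extVanishing_rightDual {n : ℕ} [HasInjectiveDimensionLE (ModuleCat.of Aᵐᵒᵖ A) n]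
    (N : Type u) [AddCommGroup N] [Module A N] [Module.Finite A N]
    (hN : ExtVanishing (R := A) A 0 N) :
    ExtVanishing (R := Aᵐᵒᵖ) A 0 (N →ₗ[A] A) := by
  suffices ∀ (d m : ℕ), m + d = n → ∀ (N : Type u) [AddCommGroup N] [Module A N]
      [Module.Finite A N], ExtVanishing (R := A) A 0 N →
        ExtVanishing (R := Aᵐᵒᵖ) A m (N →ₗ[A] A) from this n 0 (zero_add n) N hN
  intro d
  induction d with
  | zero =>
    rintro m rfl N _ _ _ _ i hi
    exact HasInjectiveDimensionLT.subsingleton _ (m + 0 + 1) i (by lia) _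
  | succ d ih =>
    intro m hm N _ _ _ hN
    obtain ⟨K, r, f, g, hf, hfg, hg⟩ := exists_finite_presentation (A := A) N
    have hK : ExtVanishing (R := A) A 0 K :=
      .left hf hfg hg (extVanishing_of_projective _) (fun i hi ↦ hN i (by lia))
    exact ExtVanishing.left (rightDualMap_injective hg) (rightDualMap_exact hfg hg)
      (surjective_rightDualMap_of_extVanishing hf hfg hg hN) (extVanishing_of_projective _)
      (ih (m + 1) (by lia) K hK)

/-- If the right self-injective dimension is finite, a finitely generated module `N` with
`Ext^i(N, A) = 0` for all `i > 0` is torsionless. -/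
lemma eq_zero_of_forall_linearForm {n : ℕ} [HasInjectiveDimensionLE (ModuleCat.of Aᵐᵒᵖ A) n]
    {N : Type u} [AddCommGroup N] [Module A N] [Module.Finite A N]
    (hN : ExtVanishing (R := A) A 0 N) (x : N) (hx : ∀ φ : N →ₗ[A] A, φ x = 0) : x = 0 := by
  obtain ⟨K, r, f, g, hf, hfg, hg⟩ := exists_finite_presentation (A := A) N
  have hK : ExtVanishing (R := A) A 0 K :=
    .left hf hfg hg (extVanishing_of_projective _) (fun i hi ↦ hN i (by lia))
  obtain ⟨K', r', f', g', hf', hfg', hg'⟩ := exists_finite_presentation (A := A) K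
  have hK' : ExtVanishing (R := A) A 0 K' :=
    .left hf' hfg' hg' (extVanishing_of_projective _) (fun i hi ↦ hK i (by lia))
  obtain ⟨p, rfl⟩ := hg x
  -- Evaluation at `p` kills the forms coming from `N`, so it descends to the dual of `K`. It then
  -- extends to the dual of the free cover of `K`, where it is evaluation at some `q`; hence `p`
  -- comes from `K`.
  obtain ⟨θ, hθ⟩ := exists_factor_of_exact (rightDualMap_exact hfg hg)
    (surjective_rightDualMap_of_extVanishing hf hfg hg hN) (rightDualEval p) (by
      ext φ
      exact hx φ)
  obtain ⟨Θ, hΘ⟩ := (extVanishing_rightDual (n := n) K' hK').exists_extension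
    (rightDualMap_injective hg') (rightDualMap_exact hfg' hg')
    (surjective_rightDualMap_of_extVanishing hf' hfg' hg' hK) θ
  obtain ⟨q, rfl⟩ := rightDualEval_surjective r' Θ
  have hp : p = f (g' q) := eq_of_forall_linearForm fun φ ↦ by
    have h₁ := LinearMap.congr_fun hθ φ
    have h₂ := LinearMap.congr_fun hΘ (rightDualMap f φ)
    exact h₁.symm.trans h₂.symm
  rw [hp, hfg.apply_apply_eq_zero]

/-- A finitely generated module `N` with `Ext^i(N, A) = 0` for all `i > 0` embeds into a free
module of finite rank with a cokernel which has the same property. -/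
lemma exists_cosyzygy {n : ℕ} [HasInjectiveDimensionLE (ModuleCat.of Aᵐᵒᵖ A) n]
    [IsNoetherian Aᵐᵒᵖ A] (N : Type u) [AddCommGroup N] [Module A N] [Module.Finite A N]
    (hN : ExtVanishing (R := A) A 0 N) :
    ∃ (K : FGModuleCat.{u} A) (r : ℕ) (f : N →ₗ[A] (Fin r → A)) (g : (Fin r → A) →ₗ[A] K),
      Function.Injective f ∧ Function.Exact f g ∧ Function.Surjective g ∧
        ExtVanishing (R := A) A 0 K := by
  have : Module.Finite Aᵐᵒᵖ (N →ₗ[A] A) := by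
    obtain ⟨m, g, hg⟩ := Module.Finite.exists_fin' A N
    have := isNoetherian_of_linearEquiv ((Pi.basisFun A (Fin m)).constr (M' := A) Aᵐᵒᵖ)
    exact Module.Finite.of_injective (rightDualMap g) (rightDualMap_injective hg)
  obtain ⟨r, s, hs⟩ := Module.Finite.exists_fin (R := Aᵐᵒᵖ) (M := N →ₗ[A] A)
  -- Since `s` generates the dual, every form on `N` extends along `LinearMap.pi s`. With
  -- torsionlessness this gives injectivity; with `of_exists_extension` it gives the vanishing for
  -- the cokernel.
  have hfac (φ : N →ₗ[A] A) : ∃ ψ : (Fin r → A) →ₗ[A] A, ψ ∘ₗ LinearMap.pi s = φ := by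
    obtain ⟨c, rfl⟩ := (Submodule.mem_span_range_iff_exists_fun Aᵐᵒᵖ).1
      (hs ▸ Submodule.mem_top (x := φ))
    refine ⟨∑ i, c i • LinearMap.proj i, ?_⟩
    ext x
    simp
  have hinj : Function.Injective (LinearMap.pi s) := by
    rw [injective_iff_map_eq_zero]
    intro x hx
    refine eq_zero_of_forall_linearForm (n := n) hN x fun φ ↦ ?_
    obtain ⟨ψ, rfl⟩ := hfac φ
    simp [hx]
  have hex := LinearMap.exact_map_mkQ_range (LinearMap.pi s)
  exact ⟨FGModuleCat.of A (_ ⧸ LinearMap.range (LinearMap.pi s)), r, LinearMap.pi s,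
    (LinearMap.range (LinearMap.pi s)).mkQ, hinj, hex, Submodule.mkQ_surjective _,
    .of_exists_extension hinj hex (Submodule.mkQ_surjective _) hN hfac⟩

end Gorenstein

end Dual

/-- A relation which is total in both directions admits bi-infinite chains. -/
lemma exists_int_chain {α : Type*} (r : α → α → Prop) (h₁ : ∀ a, ∃ b, r a b)
    (h₂ : ∀ a, ∃ b, r b a) (a : α) : ∃ c : ℤ → α, c 0 = a ∧ ∀ n, r (c n) (c (n + 1)) := by
  choose s hs using h₁
  choose p hp using h₂
  refine ⟨fun n ↦ match n with
    | .ofNat m => s^[m] a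
    | .negSucc m => p^[m + 1] a, rfl, fun n ↦ ?_⟩
  match n with
  | .ofNat m =>
    change r (s^[m] a) (s^[m + 1] a)
    rw [Function.iterate_succ_apply']
    exact hs _
  | .negSucc 0 => exact hp a
  | .negSucc (m + 1) =>
    change r (p^[m + 1 + 1] a) (p^[m + 1] a)
    rw [Function.iterate_succ_apply' p (m + 1)]
    exact hp _

lemma exists_lift_of_exact {R : Type*} [Ring R] {N P M L : Type*} [AddCommGroup N] [Module R N]
    [AddCommGroup P] [Module R P] [AddCommGroup M] [Module R M] [AddCommGroup L] [Module R L]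
    {f : N →ₗ[R] P} {g : P →ₗ[R] M} (hf : Function.Injective f) (hfg : Function.Exact f g)
    (φ : L →ₗ[R] P) (hφ : g ∘ₗ φ = 0) : ∃ ψ : L →ₗ[R] N, f ∘ₗ ψ = φ := by
  have h (x : L) : φ x ∈ LinearMap.range f := (hfg _).1 (LinearMap.congr_fun hφ x)
  refine ⟨(LinearEquiv.ofInjective f hf).symm ∘ₗ φ.codRestrict _ h, ?_⟩
  ext x
  exact congrArg Subtype.val
    ((LinearEquiv.ofInjective f hf).apply_symm_apply (φ.codRestrict _ h x))

/-! ### Complete resolutions, lifting and approximations -/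

section

variable {A : Type u} [Ring A]

/-- The short exact sequences are spliced at the `c n`. A map to `Q` killed by the preceding
differential descends to the next `c n`, then extends along its embedding because the cokernel is
again in the chain. -/
lemma gorensteinProjective_of_chain (c : ℤ → FGModuleCat.{u} A) (r : ℤ → ℕ)
    (f : ∀ n, c n →ₗ[A] (Fin (r n) → A)) (g : ∀ n, (Fin (r n) → A) →ₗ[A] c (n + 1))
    (hf : ∀ n, Function.Injective (f n)) (hfg : ∀ n, Function.Exact (f n) (g n))
    (hg : ∀ n, Function.Surjective (g n)) (hc : ∀ n, ExtVanishing (R := A) A 0 (c n)) :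
    gorensteinProjective A (c 0) := by
  let X (n : ℤ) : FGModuleCat.{u} A := FGModuleCat.of A (Fin (r n) → A)
  let d (n : ℤ) : X n ⟶ X (n + 1) := FGModuleCat.ofHom (f (n + 1) ∘ₗ g n)
  have hd (n : ℤ) : d n ≫ d (n + 1) = 0 := by
    refine FGModuleCat.hom_ext (LinearMap.ext fun x ↦ ?_)
    change f _ (g (n + 1) (f (n + 1) (g n x))) = 0
    rw [(hfg _).apply_apply_eq_zero, map_zero]
  let T := CochainComplex.of X d hd
  have hT (n : ℤ) : T.d n (n + 1) = d n := CochainComplex.of_d _ _ _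
  refine ⟨T, fun n ↦ inferInstanceAs (Module.Projective A (Fin (r n) → A)), ?_, ?_, ?_⟩
  · suffices ∀ i j k : ℤ, i + 1 = j → j + 1 = k →
        Function.Exact (T.d i j).hom.hom (T.d j k).hom.hom from
      fun n ↦ this _ _ _ (by lia) rfl
    rintro i _ _ rfl rfl
    rw [hT, hT]
    intro (x : Fin (r (i + 1)) → A)
    change f _ (g (i + 1) x) = 0 ↔ ∃ y, f (i + 1) (g i y) = x
    rw [map_eq_zero_iff _ (hf _), hfg _ x]
    exact ⟨fun ⟨y, hy⟩ ↦ (hg i y).imp fun z hz ↦ by rw [hz, hy], fun ⟨y, hy⟩ ↦ ⟨_, hy⟩⟩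
  · suffices ∀ Q : FGModuleCat A, Module.Projective A Q → ∀ (i j k : ℤ), i + 1 = j → j + 1 = k →
        ∀ φ : T.X j ⟶ Q, T.d i j ≫ φ = 0 → ∃ ψ : T.X k ⟶ Q, T.d j k ≫ ψ = φ from
      fun Q hQ n φ hφ ↦ this Q hQ _ _ _ (by lia) rfl φ hφ
    rintro Q hQ i _ _ rfl rfl φ hφ
    rw [hT] at hφ ⊢
    let φ' : (Fin (r (i + 1)) → A) →ₗ[A] Q := φ.hom.hom
    obtain ⟨ψ, hψ⟩ := exists_factor_of_exact (hfg (i + 1)) (hg (i + 1)) φ' (by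
      ext x
      obtain ⟨y, rfl⟩ := hg i x
      exact LinearMap.congr_fun (congrArg (fun a ↦ a.hom.hom) hφ) y)
    obtain ⟨χ, hχ⟩ := (hc _).exists_extension_projective (hf _) (hfg (i + 1 + 1)) (hg _) ψ
    refine ⟨FGModuleCat.ofHom χ, FGModuleCat.hom_ext (LinearMap.ext fun x ↦ ?_)⟩
    exact (LinearMap.congr_fun hχ (g (i + 1) x)).trans (LinearMap.congr_fun hψ x)
  · have h (i j : ℤ) (hij : i + 1 = j) :
        LinearMap.range (f j) = LinearMap.range (T.d i j).hom.hom := by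
      subst hij
      rw [hT]
      exact (LinearMap.range_comp_of_range_eq_top _ (LinearMap.range_eq_top.2 (hg i))).symm
    exact ⟨(LinearEquiv.ofInjective (f 0) (hf 0)).trans (LinearEquiv.ofEq _ _ (h _ _ rfl))⟩

/-- Cosyzygies continue the chain to the right and syzygies to the left; both preserve the vanishing
of `Ext`. -/
lemma gorensteinProjective_of_extVanishing [IsNoetherianRing A] [IsNoetherian Aᵐᵒᵖ A] {n : ℕ}
    [HasInjectiveDimensionLE (ModuleCat.of Aᵐᵒᵖ A) n] (N : FGModuleCat.{u} A)
    (hN : ExtVanishing (R := A) A 0 N) : gorensteinProjective A N := by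
  obtain ⟨c, hc₀, hc⟩ := exists_int_chain
    (α := { N : FGModuleCat.{u} A // ExtVanishing (R := A) A 0 N })
    (fun N K ↦ ∃ (r : ℕ) (f : N.1 →ₗ[A] (Fin r → A)) (g : (Fin r → A) →ₗ[A] K.1),
      Function.Injective f ∧ Function.Exact f g ∧ Function.Surjective g)
    (fun N ↦ by
      obtain ⟨K, r, f, g, hf, hfg, hg, hK⟩ := exists_cosyzygy (n := n) N.1 N.2
      exact ⟨⟨K, hK⟩, r, f, g, hf, hfg, hg⟩)
    (fun N ↦ by
      obtain ⟨K, r, f, g, hf, hfg, hg⟩ := exists_finite_presentation (A := A) N.1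
      exact ⟨⟨K, .left hf hfg hg (extVanishing_of_projective _)
        (fun i hi ↦ N.2 i (by lia))⟩, r, f, g, hf, hfg, hg⟩) ⟨N, hN⟩
  choose r f g hf hfg hg using hc
  have := gorensteinProjective_of_chain (fun n ↦ (c n).1) r f g hf hfg hg (fun n ↦ (c n).2)
  rwa [hc₀] at this

/-- The finitely generated modules of finite projective dimension. -/
inductive FiniteProjDim : FGModuleCat.{u} A → Prop
  | of_projective (M : FGModuleCat.{u} A) (hM : Module.Projective A M) : FiniteProjDim M
  | of_exact (N P M : FGModuleCat.{u} A) (f : N →ₗ[A] P) (g : P →ₗ[A] M)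
      (hf : Function.Injective f) (hfg : Function.Exact f g) (hg : Function.Surjective g)
      (hP : Module.Projective A P) (hN : FiniteProjDim N) : FiniteProjDim M

/-- Exactness of `Hom(T, -)` passes from `N` and `P` to the quotient `M`: a lift of `φ` to `P` is
corrected by a map through `N` until it becomes a cocycle. -/
lemma FiniteProjDim.exists_extension (T : CochainComplex (FGModuleCat.{u} A) ℤ)
    (hT : ∀ n : ℤ, Module.Projective A (T.X n))
    (hTQ : ∀ Q : FGModuleCat.{u} A, Module.Projective A Q → ∀ (n : ℤ) (f : T.X n ⟶ Q),
      T.d (n - 1) n ≫ f = 0 → ∃ g : T.X (n + 1) ⟶ Q, T.d n (n + 1) ≫ g = f)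
    {Y : FGModuleCat.{u} A} (hY : FiniteProjDim Y) {i j k : ℤ} (hij : i + 1 = j)
    (hjk : j + 1 = k) (φ : T.X j →ₗ[A] Y) (hφ : φ ∘ₗ (T.d i j).hom.hom = 0) :
    ∃ ψ : T.X k →ₗ[A] Y, ψ ∘ₗ (T.d j k).hom.hom = φ := by
  have key (Q : FGModuleCat.{u} A) (hQ : Module.Projective A Q) {i j k : ℤ} (hij : i + 1 = j)
      (hjk : j + 1 = k) (φ : T.X j →ₗ[A] Q) (hφ : φ ∘ₗ (T.d i j).hom.hom = 0) :
      ∃ ψ : T.X k →ₗ[A] Q, ψ ∘ₗ (T.d j k).hom.hom = φ := by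
    obtain rfl : i = j - 1 := by lia
    subst hjk
    obtain ⟨ψ, hψ⟩ := hTQ Q hQ j (FGModuleCat.ofHom φ) (by
      ext x
      exact LinearMap.congr_fun hφ x)
    exact ⟨ψ.hom.hom, congrArg (fun a ↦ a.hom.hom) hψ⟩
  induction hY generalizing i j k with
  | of_projective M hM => exact key M hM hij hjk φ hφ
  | of_exact N P M f g hf hfg hg hP hN ih =>
    obtain ⟨φ', rfl⟩ := Module.projective_lifting_property g φ hg
    obtain ⟨h, hh⟩ := exists_lift_of_exact hf hfg (φ' ∘ₗ (T.d i j).hom.hom) hφ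
    -- The correction `h` lives one degree to the left, so the induction has to range over all
    -- degrees.
    obtain ⟨h', hh'⟩ := ih (i := i - 1) (sub_add_cancel i 1) hij h (by
      ext x
      apply hf
      refine (LinearMap.congr_fun hh _).trans ?_
      have : T.d (i - 1) i ≫ T.d i j = 0 := T.d_comp_d _ _ _
      have := LinearMap.congr_fun (congrArg (fun a ↦ a.hom.hom) this) x
      exact (congrArg φ' this).trans (by simp))
    obtain ⟨ψ, hψ⟩ := key P hP hij hjk (φ' - f ∘ₗ h') (by
      rw [LinearMap.sub_comp, LinearMap.comp_assoc, hh', hh, sub_self])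
    refine ⟨g ∘ₗ ψ, ?_⟩
    rw [LinearMap.comp_assoc, hψ, LinearMap.comp_sub, ← LinearMap.comp_assoc,
      hfg.linearMap_comp_eq_zero, LinearMap.zero_comp, sub_zero]

/-- Maps from a Gorenstein projective module lift along epimorphisms whose kernel has finite
projective dimension. -/
lemma gorensteinProjective_exists_lift {G : FGModuleCat.{u} A} (hG : gorensteinProjective A G)
    {Y : FGModuleCat.{u} A} {E M : Type*} [AddCommGroup E] [Module A E] [AddCommGroup M]
    [Module A M] (hY : FiniteProjDim Y)
    {f : Y →ₗ[A] E} {g : E →ₗ[A] M} (hf : Function.Injective f) (hfg : Function.Exact f g)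
    (hg : Function.Surjective g) (φ : G →ₗ[A] M) : ∃ ψ : G →ₗ[A] E, g ∘ₗ ψ = φ := by
  obtain ⟨T, hT, hT', hTQ, ⟨e⟩⟩ := hG
  let q : T.X (-1) →ₗ[A] G := e.symm ∘ₗ (T.d (-1) 0).hom.hom.rangeRestrict
  have hq : Function.Surjective q :=
    e.symm.surjective.comp (LinearMap.surjective_rangeRestrict _)
  -- `G` is the cokernel of `T⁻² → T⁻¹`, so a map out of `G` is a map out of `T⁻¹` killing the image
  -- of the differential.
  have hdq : Function.Exact (T.d (-2) (-1)).hom.hom q := by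
    intro x
    refine Iff.trans ?_ (hT' (-1) x)
    refine (map_eq_zero_iff _ e.symm.injective).trans ?_
    exact Subtype.ext_iff
  obtain ⟨Φ, hΦ⟩ := Module.projective_lifting_property g (φ ∘ₗ q) hg
  obtain ⟨h, hh⟩ := exists_lift_of_exact hf hfg (Φ ∘ₗ (T.d (-2) (-1)).hom.hom) (by
    rw [← LinearMap.comp_assoc, hΦ, LinearMap.comp_assoc, hdq.linearMap_comp_eq_zero,
      LinearMap.comp_zero])
  obtain ⟨χ, hχ⟩ := hY.exists_extension T hT hTQ (i := -3) (j := -2) (k := -1) rfl rfl h (by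
    ext x
    apply hf
    refine (LinearMap.congr_fun hh _).trans ?_
    have : T.d (-3) (-2) ≫ T.d (-2) (-1) = 0 := T.d_comp_d _ _ _
    have := LinearMap.congr_fun (congrArg (fun a ↦ a.hom.hom) this) x
    exact (congrArg Φ this).trans (by simp))
  obtain ⟨ψ, hψ⟩ := exists_factor_of_exact hdq hq (Φ - f ∘ₗ χ) (by
    rw [LinearMap.sub_comp, LinearMap.comp_assoc, hχ, hh, sub_self])
  refine ⟨ψ, ?_⟩
  ext x
  obtain ⟨y, rfl⟩ := hq x
  have h₁ := LinearMap.congr_fun hψ y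
  have h₂ := LinearMap.congr_fun hΦ y
  simp only [LinearMap.comp_apply, LinearMap.sub_apply] at h₁ h₂ ⊢
  rw [h₁, map_sub, h₂, hfg.apply_apply_eq_zero, sub_zero]

variable [IsNoetherianRing A] [IsNoetherian Aᵐᵒᵖ A]

/-- If a syzygy of `M` has an approximation by a module `G` with `Ext^i(G, A) = 0` for `i > 0`
whose kernel has finite projective dimension, then so does `M`. -/
lemma exists_approximation_of_syzygy {n : ℕ} [HasInjectiveDimensionLE (ModuleCat.of Aᵐᵒᵖ A) n]
    {N M : FGModuleCat.{u} A} {m : ℕ} {ι : N →ₗ[A] (Fin m → A)} {π : (Fin m → A) →ₗ[A] M}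
    (hι : Function.Injective ι) (hιπ : Function.Exact ι π) (hπ : Function.Surjective π)
    {Y G : FGModuleCat.{u} A} {f : Y →ₗ[A] G} {g : G →ₗ[A] N}
    (hf : Function.Injective f) (hfg : Function.Exact f g)
    (hg : Function.Surjective g) (hY : FiniteProjDim Y) (hG : ExtVanishing (R := A) A 0 G) :
    ∃ (Y' G' : FGModuleCat.{u} A) (f' : Y' →ₗ[A] G') (g' : G' →ₗ[A] M),
      Function.Injective f' ∧ Function.Exact f' g' ∧ Function.Surjective g' ∧
        FiniteProjDim Y' ∧ ExtVanishing (R := A) A 0 G' := by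
  obtain ⟨G₁, r, a, b, ha, hab, hb, hG₁⟩ := exists_cosyzygy (n := n) G hG
  obtain ⟨ψ, hψ⟩ := hG₁.exists_extension_projective ha hab hb (ι ∘ₗ g)
  obtain ⟨γ, hγ⟩ := exists_factor_of_exact hab hb (π ∘ₗ ψ) (by
    rw [LinearMap.comp_assoc, hψ, ← LinearMap.comp_assoc, hιπ.linearMap_comp_eq_zero,
      LinearMap.zero_comp])
  have hψ' (x : G) : ψ (a x) = ι (g x) := LinearMap.congr_fun hψ x
  have hγ' (t : Fin r → A) : γ (b t) = π (ψ t) := LinearMap.congr_fun hγ t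
  -- `G₁ ⊕ A^m` maps onto `M` with kernel the image of `A^r` under `(b, ψ)`; this kernel is `A^r /
  -- Y`, so it has finite projective dimension.
  let q : (G₁ × (Fin m → A)) →ₗ[A] M := γ.coprod (-π)
  have hq : Function.Surjective q := fun x ↦ by
    obtain ⟨y, rfl⟩ := hπ x
    exact ⟨(0, -y), by simp [q]⟩
  let c : (Fin r → A) →ₗ[A] LinearMap.ker q := (b.prod ψ).codRestrict _ fun t ↦ by
    simp [q, hγ']
  have hc : Function.Surjective c := by
    rintro ⟨⟨x, p⟩, hxp⟩
    obtain ⟨t, rfl⟩ := hb x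
    have : π (ψ t - p) = 0 := by
      simpa [q, hγ', sub_eq_add_neg] using hxp
    obtain ⟨y, hy⟩ := (hιπ _).1 this
    obtain ⟨z, rfl⟩ := hg y
    refine ⟨t - a z, Subtype.ext (Prod.ext ?_ ?_)⟩
    · change b (t - a z) = b t
      rw [map_sub, hab.apply_apply_eq_zero, sub_zero]
    · change ψ (t - a z) = p
      rw [map_sub, hψ', hy, sub_sub_cancel]
  have hac : Function.Exact (a ∘ₗ f) c := by
    intro t
    have : c t = 0 ↔ b t = 0 ∧ ψ t = 0 := by
      rw [Subtype.ext_iff]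
      exact Prod.ext_iff
    rw [this]
    constructor
    · rintro ⟨h₁, h₂⟩
      obtain ⟨x, rfl⟩ := (hab t).1 h₁
      rw [hψ', map_eq_zero_iff _ hι] at h₂
      obtain ⟨y, rfl⟩ := (hfg x).1 h₂
      exact ⟨y, rfl⟩
    · rintro ⟨y, rfl⟩
      rw [LinearMap.comp_apply, hab.apply_apply_eq_zero, hψ', hfg.apply_apply_eq_zero, map_zero]
      exact ⟨rfl, rfl⟩
  refine ⟨FGModuleCat.of A (LinearMap.ker q), FGModuleCat.of A (G₁ × (Fin m → A)),
    (LinearMap.ker q).subtype, q, (LinearMap.ker q).injective_subtype,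
    LinearMap.exact_subtype_ker_map q, hq, ?_, ?_⟩
  · exact .of_exact Y (FGModuleCat.of A (Fin r → A)) _ (a ∘ₗ f) c (ha.comp hf) hac hc
      (inferInstanceAs (Module.Projective A (Fin r → A))) hY
  · exact ExtVanishing.middle (f := LinearMap.inr A G₁ (Fin m → A))
      (g := LinearMap.fst A G₁ (Fin m → A)) LinearMap.inr_injective
      Function.Exact.inr_fst LinearMap.fst_surjective (extVanishing_of_projective 0) hG₁

/-- Passing to a syzygy lowers the bound `d` by one; at `d = 0` the module approximates itself with
zero kernel. -/
lemma exists_approximation {n d : ℕ} [HasInjectiveDimensionLE (ModuleCat.of Aᵐᵒᵖ A) n]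
    (M : FGModuleCat.{u} A) (hM : ExtVanishing (R := A) A d M) :
    ∃ (Y G : FGModuleCat.{u} A) (f : Y →ₗ[A] G) (g : G →ₗ[A] M),
      Function.Injective f ∧ Function.Exact f g ∧ Function.Surjective g ∧
        FiniteProjDim Y ∧ ExtVanishing (R := A) A 0 G := by
  induction d generalizing M with
  | zero =>
    refine ⟨FGModuleCat.of A PUnit.{u + 1}, M, 0, LinearMap.id, Function.injective_of_subsingleton _, ?_,
      Function.surjective_id,
      .of_projective _ (inferInstanceAs (Module.Projective A PUnit.{u + 1})), hM⟩
    intro x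
    exact ⟨fun h ↦ ⟨0, h.symm⟩, fun ⟨_, h⟩ ↦ h.symm⟩
  | succ d ih =>
    obtain ⟨N, m, ι, π, hι, hιπ, hπ⟩ := exists_finite_presentation (A := A) M
    obtain ⟨Y, G, f, g, hf, hfg, hg, hY, hG⟩ :=
      ih N (.left hι hιπ hπ (extVanishing_of_projective _) hM)
    exact exists_approximation_of_syzygy (n := n) hι hιπ hπ hf hfg hg hY hG

end

/-! ### Resolving modules by the `Ext`-orthogonal class -/

section

variable {A : Type u} [Ring A]

/-- The finitely generated modules `N` such that `Ext^i(N, A) = 0` for all `i > 0`. -/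
def extOrthogonal (A : Type u) [Ring A] : ObjectProperty (FGModuleCat.{u} A) :=
  fun N ↦ ExtVanishing (R := A) A 0 N

instance : (extOrthogonal A).IsClosedUnderIsomorphisms where
  of_iso e h := h.of_equiv (FGModuleCat.isoToLinearEquiv e)

lemma extOrthogonal_zero : extOrthogonal A 0 := by
  have : Subsingleton (0 : FGModuleCat.{u} A) := by
    refine subsingleton_of_forall_eq 0 fun x ↦ ?_
    have h : 𝟙 (0 : FGModuleCat.{u} A) = 0 := (isZero_zero _).eq_of_src _ _
    exact LinearMap.congr_fun (congrArg (fun a ↦ a.hom.hom) h) x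
  exact extVanishing_of_projective 0

lemma extOrthogonal_biprod (X Y : FGModuleCat.{u} A) (hX : extOrthogonal A X)
    (hY : extOrthogonal A Y) : extOrthogonal A (X ⊞ Y) := by
  have h {U V : FGModuleCat.{u} A} {f g : U ⟶ V} (hfg : f = g) (x : U) :
      f.hom.hom x = g.hom.hom x := by rw [hfg]
  refine ExtVanishing.middle (f := (biprod.inl : X ⟶ X ⊞ Y).hom.hom)
    (g := (biprod.snd : X ⊞ Y ⟶ Y).hom.hom) ?_ ?_ ?_ hX hY
  · exact Function.LeftInverse.injective (g := (biprod.fst : X ⊞ Y ⟶ X).hom.hom)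
      (h biprod.inl_fst)
  · intro x
    constructor
    · intro hx
      have := h (biprod.total (X := X) (Y := Y)) x
      refine ⟨(biprod.fst : X ⊞ Y ⟶ X).hom.hom x, ?_⟩
      refine Eq.trans ?_ this
      change _ = (biprod.inl : X ⟶ X ⊞ Y).hom.hom ((biprod.fst : X ⊞ Y ⟶ X).hom.hom x) +
        (biprod.inr : Y ⟶ X ⊞ Y).hom.hom ((biprod.snd : X ⊞ Y ⟶ Y).hom.hom x)
      rw [hx, map_zero, add_zero]
    · rintro ⟨y, rfl⟩
      exact h (biprod.inl_snd (X := X) (Y := Y)) y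
  · exact Function.RightInverse.surjective (g := (biprod.inr : Y ⟶ X ⊞ Y).hom.hom)
      (h biprod.inr_snd)

/-- `Hom(X, -)` is left exact, so the lifting hypothesis is needed only for surjectivity on the
right. -/
lemma shortExact_map_preadditiveCoyoneda {N P M : FGModuleCat.{u} A} (f : N ⟶ P) (g : P ⟶ M)
    (hf : Function.Injective f.hom.hom) (hfg : Function.Exact f.hom.hom g.hom.hom)
    (w : f ≫ g = 0) (X : FGModuleCat.{u} A)
    (hX : ∀ φ : X →ₗ[A] M, ∃ ψ : X →ₗ[A] P, g.hom.hom ∘ₗ ψ = φ) :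
    ((ShortComplex.mk f g w).map (preadditiveCoyoneda.obj (Opposite.op X))).ShortExact where
  exact := by
    rw [ShortComplex.ab_exact_iff]
    intro (φ : X ⟶ P) (hφ : φ ≫ g = 0)
    obtain ⟨ψ, hψ⟩ := exists_lift_of_exact hf hfg φ.hom.hom (congrArg (fun a ↦ a.hom.hom) hφ)
    exact ⟨(FGModuleCat.ofHom ψ : X ⟶ N), FGModuleCat.hom_ext hψ⟩
  mono_f := by
    rw [AddCommGrpCat.mono_iff_injective]
    intro (φ : X ⟶ N) (ψ : X ⟶ N) (h : φ ≫ f = ψ ≫ f)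
    exact FGModuleCat.hom_ext (LinearMap.ext fun x ↦
      hf (LinearMap.congr_fun (congrArg (fun a ↦ a.hom.hom) h) x))
  epi_g := by
    rw [AddCommGrpCat.epi_iff_surjective]
    intro (φ : X ⟶ M)
    obtain ⟨ψ, hψ⟩ := hX φ.hom.hom
    exact ⟨(FGModuleCat.ofHom ψ : X ⟶ P), FGModuleCat.hom_ext hψ⟩

/-- Because `N` has finite projective dimension, maps from Gorenstein projectives lift to `P`, and
the sequence is relatively exact. -/
lemma resolvable_single_of_exact (hA : extOrthogonal A ≤ gorensteinProjective A)
    {N P M : FGModuleCat.{u} A} {f : N →ₗ[A] P} {g : P →ₗ[A] M}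
    (hf : Function.Injective f) (hfg : Function.Exact f g) (hg : Function.Surjective g)
    (hN : FiniteProjDim N) (n : ℤ)
    (h₁ : resolvable (gorensteinProjective A) (extOrthogonal A)
      ((HomotopyCategory.quotient _ (ComplexShape.up ℤ)).obj
        ((HomologicalComplex.single _ (ComplexShape.up ℤ) n).obj N)))
    (hP : extOrthogonal A P) :
    resolvable (gorensteinProjective A) (extOrthogonal A)
      ((HomotopyCategory.quotient _ (ComplexShape.up ℤ)).obj
        ((HomologicalComplex.single _ (ComplexShape.up ℤ) n).obj M)) := by
  have w : (FGModuleCat.ofHom f : N ⟶ P) ≫ (FGModuleCat.ofHom g : P ⟶ M) = 0 := by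
    ext x
    exact hfg.apply_apply_eq_zero x
  exact resolvable_single_of_shortExact hA extOrthogonal_zero extOrthogonal_biprod
    (ShortComplex.mk (FGModuleCat.ofHom f : N ⟶ P) (FGModuleCat.ofHom g : P ⟶ M) w)
    (fun X hX ↦ shortExact_map_preadditiveCoyoneda _ _ hf hfg w X
      (gorensteinProjective_exists_lift hX hN hf hfg hg)) n h₁
    (resolvable_single extOrthogonal_zero hP n)

/-- Each stage of a finite projective resolution has a kernel of finite projective dimension, so the
resolution is relatively exact throughout. -/
lemma resolvable_single_of_finiteProjDim (hA : extOrthogonal A ≤ gorensteinProjective A)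
    {M : FGModuleCat.{u} A} (hM : FiniteProjDim M) (n : ℤ) :
    resolvable (gorensteinProjective A) (extOrthogonal A)
      ((HomotopyCategory.quotient _ (ComplexShape.up ℤ)).obj
        ((HomologicalComplex.single _ (ComplexShape.up ℤ) n).obj M)) := by
  induction hM with
  | of_projective M hM =>
    exact resolvable_single extOrthogonal_zero (extVanishing_of_projective 0) n
  | of_exact N P M f g hf hfg hg hP hN ih =>
    exact resolvable_single_of_exact hA hf hfg hg hN n ih (extVanishing_of_projective 0)

end

end RelativeDerived

theorem corollary4p5 (k : Type*) [Field k] (A : Type u) [Ring A] [Algebra k A]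
    [Module.Finite k A] (hA : RelativeDerived.IsGorenstein A)
    (X : RelativeDerived.SingularityCategory (RelativeDerived.gorensteinProjective A)) :
    IsZero X := by
  obtain ⟨⟨d, _⟩, ⟨n, _⟩⟩ := hA
  have : IsNoetherianRing A := isNoetherian_of_tower k inferInstance
  have : IsNoetherian Aᵐᵒᵖ A := isNoetherian_of_tower k inferInstance
  have h : RelativeDerived.extOrthogonal A ≤ RelativeDerived.gorensteinProjective A :=
    fun N hN ↦ RelativeDerived.gorensteinProjective_of_extVanishing (n := n) N hN
  refine RelativeDerived.isZero_singularityCategory_of_resolvable h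
    RelativeDerived.extOrthogonal_zero RelativeDerived.extOrthogonal_biprod (fun M ↦ ?_) X
  -- The left injective dimension supplies the bound `d` valid for every `M`; the right one, `n`,
  -- supplies the cosyzygies.
  obtain ⟨Y, G, f, g, hf, hfg, hg, hY, hG⟩ := RelativeDerived.exists_approximation (n := n)
    (d := d) M (fun i hi ↦ HasInjectiveDimensionLT.subsingleton _ (d + 1) i (by lia) _)
  exact RelativeDerived.resolvable_single_of_exact h hf hfg hg hY 0
    (RelativeDerived.resolvable_single_of_finiteProjDim h hY 0) hG
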